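/- Let $\mathfrak C$ be a monster model of a complete theory in a language $\mathcal L$, of monstrosity $\kappa$ (that is, $\kappa$ is an uncountable cardinal, $\kappa>|\mathcal L|$, and $\mathfrak C$ is $\kappa$-saturated and strongly $\kappa$-homogeneous). Call a set small if its cardinality is $<\kappa$, and a cardinal small if it is $<\kappa$; below, $A,B,C,D$ range over small subsets of $\mathfrak C$, we write $BC$ for $B\cup C$, and a finite tuple is identified with its range when it stands in an independence relation. An *independence relation* on $\mathfrak C$ is a ternary relation $\perp$ on small subsets of $\mathfrak C$ satisfying: - Invariance: $A\perp_BC\Rightarrow\sigma(A)\perp_{\sigma(B)}\sigma(C)$ for all $\sigma\in\mathrm{Aut}(\mathfrak C)$; - Normality: $A\perp_CB\Rightarrow AC\perp_CB$; - Symmetry: $A\perp_BC\Rightarrow C\perp_BA$; - Transitivity: if $B\subseteq C\subseteq D$, then $A\perp_BD$ iff $A\perp_BC$ and $A\perp_CD$; - Finite character: $A\perp_BC$ iff $A_0\perp_BC$ for all finite $A_0\subseteq A$; - Extension: for all $A,B,C$ there is $A'\equiv_BA$ with $A'\perp_BC$; - Local character: there is a small cardinal $\mu$ such that for all $A,C$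 there is $C_0\subseteq C$ with $|C_0|<\mu+|A|^+$ and $A\perp_{C_0}C$. Let $\kappa_0$ be the least regular cardinal $\mu$ such that for every finite tuple $\bar a$ and every $B$ there is $B_0\subseteq B$ with $|B_0|<\mu$ and $\bar a\perp_{B_0}B$; the relation is *superior* if $\kappa_0=\omega$. Let $\perp$ be a superior independence relation on $\mathfrak C$, and let $U$ be the associated foundation rank on complete types of finite tuples over small sets: $U(\bar a/B)\ge\alpha+1$ iff there are a small $C\supseteq B$ and $\bar a'\equiv_B\bar a$ with $\bar a'\not\perp_BC$ and $U(\bar a'/C)\ge\alpha$ (and, for limit $\lambda$, $U\geq\lambda$ iff $U\geq\alpha$ for all $\alpha<\lambda$). Let $\theta=\omega^\delta$ for some ordinal $\delta$, and assume (**) for every element $a\in\mathfrak C$ there is $n\in\mathbb N$ with $U(a/\emptyset)\le\theta\cdot n$ (the sum of $n$ copies of $\theta$). For a finite tuple $\bar a$, say that $U(\bar a/B)=U(\bar a/BC)+o(\theta)$ if there is an ordinal $\varepsilon<\theta$ with $U(\bar a/B)=U(\bar a/BC)+\varepsilon$. Define $A\perp^\theta_BC$ to mean that $U(\bar a/B)=U(\bar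 a/BC)+o(\theta)$ for every finite tuple $\bar a$ from $A$. Then $\perp^\theta$ is a superior independence relation on $\mathfrak C$, and $\perp$ refines it: $A\perp_BC$ implies $A\perp^\theta_BC$. Moreover, for every finite tuple $\bar a$ and all small $B,C$: $\bar a\perp^\theta_BC$ (for the range of $\bar a$) if and only if $U(\bar a/B)=U(\bar a/BC)+o(\theta)$. -/

import Mathlib

open Set Cardinal
open scoped FirstOrder

universe u v w x

namespace IndepRel

section ModelTheory

variable (L : FirstOrder.Language.{u, v}) {M : Type w} [L.Structure M]

/-- `a ≡_B a'`: the tuples `a` and `a'` (indexed by an arbitrary type) have the same complete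
type over the parameter set `B` in the structure `M`. -/
def SameType (B : Set M) {ι : Type x} (a a' : ι → M) : Prop :=
  ∀ φ : L[[B]].Formula ι, φ.Realize a ↔ φ.Realize a'

/-- `M` is a monster model (of its complete theory) of monstrosity `κ`, where `κ` is an
uncountable cardinal larger than the language: it is `κ`-saturated and strongly
`κ`-homogeneous. -/
structure IsMonster (L : FirstOrder.Language.{u, v}) (M : Type w) [L.Structure M] (κ : Cardinal.{w}) : Prop where
  aleph0_lt : ℵ₀ < κ
  card_lt : Cardinal.lift.{w} L.card < Cardinal.lift.{max u v} κ
  /-- Every set of formulas in one variable, over a small set of parameters, which is finitely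
  satisfiable in `M` is realized in `M`. -/
  saturated : ∀ B : Set M, #B < κ → ∀ p : Set (L[[B]].Formula (Fin 1)),
    (∀ p₀ ⊆ p, p₀.Finite → ∃ a : Fin 1 → M, ∀ φ ∈ p₀, φ.Realize a) →
      ∃ a : Fin 1 → M, ∀ φ ∈ p, φ.Realize a
  /-- Every elementary map from a small subset of `M` to `M` extends to an automorphism. -/
  homogeneous : ∀ A : Set M, #A < κ → ∀ f : A → M,
    SameType L (∅ : Set M) (fun a : A => (a : M)) f → ∃ σ : M ≃[L] M, ∀ a : A, σ a = f a

/-- The axioms of a (symmetric) independence relation on the small subsets of `M`, where small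
means of cardinality smaller than `κ`. Here `ind A B C` is to be read as "`A` is independent from
`C` over `B`". The values of `ind` on sets that are not small are irrelevant. -/
structure IsIndependenceRelation (κ : Cardinal.{w}) (ind : Set M → Set M → Set M → Prop) :
    Prop where
  invariance : ∀ σ : M ≃[L] M, ∀ A B C : Set M, #A < κ → #B < κ → #C < κ →
    ind A B C → ind (σ '' A) (σ '' B) (σ '' C)
  normality : ∀ A B C : Set M, #A < κ → #B < κ → #C < κ → ind A C B → ind (A ∪ C) C B
  symmetry : ∀ A B C : Set M, #A < κ → #B < κ → #C < κ → ind A B C → ind C B A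
  transitivity : ∀ A B C D : Set M, #A < κ → #B < κ → #C < κ → #D < κ → B ⊆ C → C ⊆ D →
    (ind A B D ↔ ind A B C ∧ ind A C D)
  finite_character : ∀ A B C : Set M, #A < κ → #B < κ → #C < κ →
    (ind A B C ↔ ∀ A₀ ⊆ A, A₀.Finite → ind A₀ B C)
  /-- There is some `A' ≡_B A` with `A'` independent from `C` over `B`. The set `A` is enumerated
  by itself, and `f` is the corresponding enumeration of `A'`. -/
  extension : ∀ A B C : Set M, #A < κ → #B < κ → #C < κ →
    ∃ f : A → M, SameType L B (fun a : A => (a : M)) f ∧ ind (range f) B C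
  local_character : ∃ κ₀ < κ, ∀ A C : Set M, #A < κ → #C < κ →
    ∃ C₀ ⊆ C, #C₀ < κ₀ + Order.succ #A ∧ ind A C₀ C

end ModelTheory

section Superior

variable {M : Type w}

/-- The smallest regular cardinal `μ` such that every finite tuple `a` is independent from every
small set `B` over some subset of `B` of cardinality less than `μ`. -/
noncomputable def kappaZero (κ : Cardinal.{w}) (ind : Set M → Set M → Set M → Prop) :
    Cardinal.{w} :=
  sInf {μ | μ.IsRegular ∧ ∀ (n : ℕ) (a : Fin n → M) (B : Set M), #B < κ →
    ∃ B₀ ⊆ B, #B₀ < μ ∧ ind (range a) B₀ B}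

/-- `ind` is superior if its local character cardinal `kappaZero` is `ω`. -/
def IsSuperior (κ : Cardinal.{w}) (ind : Set M → Set M → Set M → Prop) : Prop :=
  kappaZero κ ind = ℵ₀

end Superior

section Rank

variable (L : FirstOrder.Language.{u, v}) {M : Type w} [L.Structure M]

/-- A pair `(a, B)` stands for the complete type `tp(a/B)`. `ForkingExtension L κ ind q p` says that
`q = tp(a'/C)` is a forking extension of `p = tp(a/B)`: `C` is a small set containing `B`,
`tp(a'/C)` extends `tp(a/B)`, and `a'` is not independent from `C` over `B`. -/
def ForkingExtension (κ : Cardinal.{w}) (ind : Set M → Set M → Set M → Prop) {n : ℕ}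
    (q p : (Fin n → M) × Set M) : Prop :=
  p.2 ⊆ q.2 ∧ #q.2 < κ ∧ SameType L p.2 p.1 q.1 ∧ ¬ ind (range q.1) p.2 q.2

open Classical in
/-- The foundation rank `U(a/B)` of the type `tp(a/B)` for forking extensions, so that
`U(p) ≥ α + 1` iff `U(q) ≥ α` for some forking extension `q` of `p`. Its value is `∞` (that is, `⊤`)
if there is an infinite chain of forking extensions starting with `tp(a/B)`. -/
noncomputable def URank (κ : Cardinal.{w}) (ind : Set M → Set M → Set M → Prop) {n : ℕ}
    (a : Fin n → M) (B : Set M) : WithTop Ordinal.{w} :=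
  if h : Acc (ForkingExtension L κ ind) (a, B) then (h.rank : WithTop Ordinal.{w}) else ⊤

/-- `U(a/B) = U(a/BC) + o(θ)` for a finite tuple `a`. -/
def TupleCoarsening (κ : Cardinal.{w}) (ind : Set M → Set M → Set M → Prop) (θ : Ordinal.{w})
    {n : ℕ} (a : Fin n → M) (B C : Set M) : Prop :=
  ∃ ε < θ, URank L κ ind a B = URank L κ ind a (B ∪ C) + (ε : WithTop Ordinal.{w})

/-- The coarsening of `ind` at `θ`: every finite tuple `a` in `A` satisfies
`U(a/B) = U(a/BC) + o(θ)`. -/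
def Coarsening (κ : Cardinal.{w}) (ind : Set M → Set M → Set M → Prop) (θ : Ordinal.{w})
    (A B C : Set M) : Prop :=
  ∀ (n : ℕ) (a : Fin n → M), range a ⊆ A → TupleCoarsening L κ ind θ a B C

end Rank

end IndepRel

/-!
The rank `U` is monotone in the base and in the tuple, `U(a/C) = U(a/B)` whenever `a` is
independent from `C ⊇ B` over `B` (`URank_eq_of_ind`), and it satisfies the Lascar inequalities
`U(a/Bb) + U(b/B) ≤ U(ab/B) ≤ U(a/Bb) ⊕ U(b/B)` (`add_le_URank`, `URank_le_naturalSum`).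
Forking extensions realized by a conjugate `a'` of `a` can always be moved to `a` itself by an
automorphism over the base, so all arguments with the rank take place with a fixed tuple and a
growing base (`URank_le_of_forall`).

Since `θ` is a power of `ω`, it is closed under natural sums. Together with the hypothesis on
elements and the upper Lascar inequality this bounds the rank of each finite tuple by a finite
multiple of `θ`, so `U(a/B) = θ * k + o(θ)` for a natural number `k`, the coarse rank of `a` over
`B`. The Lascar inequalities turn into the additivity `k(ab/B) = k(a/Bb) + k(b/B)`
(`coarseRank_add`), and the coarsening says that `k(a/B) = k(a/BC)` for all finite tuples `a` in `A`
(`tupleCoarsening_iff`).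

The axioms are then those of a dimension with values in the natural numbers: symmetry holds since
`k(a/B) = k(a/Bc)` and `k(c/B) = k(c/Ba)` both say that `k(ac/B) = k(a/B) + k(c/B)`, where
superiority serves to replace `C` by a finite tuple `c`; transitivity is monotonicity of `k`; and
extension and local character are inherited from the finer relation.
-/

namespace IndepRel

/-! ### Types and automorphisms -/

section Automorphisms

variable {L : FirstOrder.Language.{u, v}} {M : Type w} [L.Structure M]

theorem sameType_iff_formula_sum {B : Set M} {ι : Type x} {a a' : ι → M} :
    SameType L B a a' ↔ ∀ φ : L.Formula (B ⊕ ι),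
      φ.Realize (Sum.elim (↑) a) ↔ φ.Realize (Sum.elim (↑) a') := by
  refine Equiv.forall_congr FirstOrder.Language.BoundedFormula.constantsVarsEquiv fun φ => ?_
  have h : ∀ b : ι → M, φ.Realize b ↔ FirstOrder.Language.Formula.Realize
      (FirstOrder.Language.BoundedFormula.constantsVarsEquiv φ) (Sum.elim (↑) b) := fun b =>
    (FirstOrder.Language.BoundedFormula.realize_constantsVarsEquiv (v := b)).symm
  rw [h, h]

theorem sameType_of_automorphism (σ : M ≃[L] M) {B : Set M} (hσ : ∀ b ∈ B, σ b = b)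
    {ι : Type x} (a : ι → M) : SameType L B a (σ ∘ a) := by
  refine sameType_iff_formula_sum.2 fun φ => ?_
  have h : (Sum.elim (↑) (σ ∘ a) : B ⊕ ι → M) = σ ∘ Sum.elim (↑) a := by
    ext (b | i)
    · exact (hσ b b.2).symm
    · rfl
  rw [h, FirstOrder.Language.StrongHomClass.realize_formula]

/-- Strong homogeneity, relative to a small set of parameters: tuples with the same type over `B`
are conjugate by an automorphism which fixes `B` pointwise. -/
theorem IsMonster.exists_automorphism {κ : Cardinal.{w}} (hM : IsMonster L M κ) {B : Set M}
    {ι : Type x} {a a' : ι → M} (hs : #(B ∪ range a : Set M) < κ) (h : SameType L B a a') :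
    ∃ σ : M ≃[L] M, (∀ b ∈ B, σ b = b) ∧ σ ∘ a = a' := by
  rw [sameType_iff_formula_sum] at h
  let s : B ⊕ ι → M := Sum.elim (↑) a
  let s' : B ⊕ ι → M := Sum.elim (↑) a'
  have hs_eq : ∀ i j, s i = s j → s' i = s' j := fun i j hij => by
    have := h (((FirstOrder.Language.Term.var i).equal (FirstOrder.Language.Term.var j)))
    simp only [FirstOrder.Language.Formula.realize_equal,
      FirstOrder.Language.Term.realize_var] at this
    exact this.1 hij
  have hsurj : ∀ y : (B ∪ range a : Set M), ∃ i, s i = y := by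
    rintro ⟨y, hy | ⟨i, rfl⟩⟩
    · exact ⟨Sum.inl ⟨y, hy⟩, rfl⟩
    · exact ⟨Sum.inr i, rfl⟩
  choose g hg using hsurj
  obtain ⟨σ, hσ⟩ := hM.homogeneous _ hs (fun y => s' (g y)) (by
    refine sameType_iff_formula_sum.2 fun φ => ?_
    have h1 := h (φ.relabel (Sum.elim (fun e => (notMem_empty _ e.2).elim) g))
    rw [FirstOrder.Language.Formula.realize_relabel,
      FirstOrder.Language.Formula.realize_relabel] at h1
    convert h1 using 2
    · ext (e | y)
      · exact (notMem_empty _ e.2).elim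
      · exact (hg y).symm
    · ext (e | y)
      · exact (notMem_empty _ e.2).elim
      · rfl)
  have key : ∀ i, σ (s i) = s' i := fun i => by
    have hi : s i ∈ B ∪ range a := by
      rcases i with b | i
      · exact Or.inl b.2
      · exact Or.inr ⟨i, rfl⟩
    exact (hσ ⟨s i, hi⟩).trans (hs_eq _ _ (hg ⟨s i, hi⟩))
  exact ⟨σ, fun b hb => key (Sum.inl ⟨b, hb⟩), funext fun i => key (Sum.inr i)⟩

theorem IsMonster.small_union {κ : Cardinal.{w}} (hM : IsMonster L M κ) {A B : Set M}
    (hA : #A < κ) (hB : #B < κ) : #(A ∪ B : Set M) < κ :=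
  (mk_union_le A B).trans_lt (add_lt_of_lt hM.aleph0_lt.le hA hB)

theorem IsMonster.small_finite {κ : Cardinal.{w}} (hM : IsMonster L M κ) {A : Set M}
    (hA : A.Finite) : #A < κ :=
  (lt_aleph0_iff_set_finite.2 hA).trans hM.aleph0_lt

theorem IsMonster.small_range {κ : Cardinal.{w}} (hM : IsMonster L M κ) {n : ℕ} (a : Fin n → M) :
    #(range a) < κ :=
  hM.small_finite (finite_range a)

theorem small_image {κ : Cardinal.{w}} {A : Set M} (hA : #A < κ) (f : M → M) : #(f '' A) < κ :=
  mk_image_le.trans_lt hA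

theorem small_subset {κ : Cardinal.{w}} {A B : Set M} (hB : #B < κ) (h : A ⊆ B) : #A < κ :=
  (mk_le_mk_of_subset h).trans_lt hB

theorem image_eq_self_of_fixes {σ : M ≃[L] M} {B : Set M} (hσ : ∀ b ∈ B, σ b = b) :
    σ '' B = B := by
  rw [image_congr hσ, image_id']

end Automorphisms

/-! ### Calculus of an independence relation -/

namespace IsIndependenceRelation

variable {L : FirstOrder.Language.{u, v}} {M : Type w} [L.Structure M] {κ : Cardinal.{w}}
  {ind : Set M → Set M → Set M → Prop} {A A' B C C' D : Set M}

theorem mono_left (hind : IsIndependenceRelation L κ ind) (hA : #A < κ) (hB : #B < κ) (hC : #C < κ)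
    (h : ind A B C) (hA' : A' ⊆ A) : ind A' B C :=
  (hind.finite_character A' B C (small_subset hA hA') hB hC).2 fun A₀ hA₀ hfin =>
    (hind.finite_character A B C hA hB hC).1 h A₀ (hA₀.trans hA') hfin

theorem mono_right (hind : IsIndependenceRelation L κ ind) (hA : #A < κ) (hB : #B < κ) (hC : #C < κ)
    (h : ind A B C) (hC' : C' ⊆ C) : ind A B C' :=
  hind.symmetry C' B A (small_subset hC hC') hB hA
    (hind.mono_left hC hB hA (hind.symmetry A B C hA hB hC h) hC')

theorem union_base_right (hM : IsMonster L M κ) (hind : IsIndependenceRelation L κ ind)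
    (hA : #A < κ) (hB : #B < κ) (hC : #C < κ) (h : ind A B C) : ind A B (B ∪ C) := by
  have h1 := hind.normality C A B hC hA hB (hind.symmetry A B C hA hB hC h)
  rw [union_comm]
  exact hind.symmetry _ _ _ (hM.small_union hC hB) hB hA h1

/-- Extension, with the new copy of `A` given by an automorphism over the base. -/
theorem exists_automorphism_left (hM : IsMonster L M κ) (hind : IsIndependenceRelation L κ ind)
    (hA : #A < κ) (hB : #B < κ) (hC : #C < κ) :
    ∃ σ : M ≃[L] M, (∀ b ∈ B, σ b = b) ∧ ind (σ '' A) B C := by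
  obtain ⟨f, hf, hi⟩ := hind.extension A B C hA hB hC
  obtain ⟨σ, hσ, rfl⟩ := hM.exists_automorphism
    (by rw [Subtype.range_coe]; exact hM.small_union hB hA) hf
  refine ⟨σ, hσ, ?_⟩
  rwa [range_comp, Subtype.range_coe] at hi

theorem exists_automorphism_right (hM : IsMonster L M κ) (hind : IsIndependenceRelation L κ ind)
    (hA : #A < κ) (hB : #B < κ) (hC : #C < κ) :
    ∃ σ : M ≃[L] M, (∀ b ∈ B, σ b = b) ∧ ind A B (σ '' C) := by
  obtain ⟨σ, hσ, h⟩ := hind.exists_automorphism_left hM hC hB hA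
  exact ⟨σ, hσ, hind.symmetry _ _ _ (small_image hC σ) hB hA h⟩

theorem base_left (hM : IsMonster L M κ) (hind : IsIndependenceRelation L κ ind)
    (hB : #B < κ) (hC : #C < κ) (hA : A ⊆ B) : ind A B C := by
  obtain ⟨σ, hσ, h⟩ := hind.exists_automorphism_left hM hB hB hC
  rw [image_eq_self_of_fixes hσ] at h
  exact hind.mono_left hB hB hC h hA

/-- Left transitivity: if `A` is independent from `C` over `B` and `A'` is independent from `C`
over `B ∪ A`, then `A ∪ A'` is independent from `C` over `B`. -/
theorem union_left (hM : IsMonster L M κ) (hind : IsIndependenceRelation L κ ind)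
    (hA : #A < κ) (hA' : #A' < κ) (hB : #B < κ) (hC : #C < κ)
    (h : ind A B C) (h' : ind A' (B ∪ A) C) : ind (A ∪ A') B C := by
  have hBA := hM.small_union hB hA
  have hBAA := hM.small_union hBA hA'
  have h1 := hind.union_base_right hM hC hB hA (hind.symmetry _ _ _ hA hB hC h)
  have h2 := hind.union_base_right hM hC hBA hA' (hind.symmetry _ _ _ hA' hBA hC h')
  have h3 := (hind.transitivity C B (B ∪ A) (B ∪ A ∪ A') hC hB hBA hBAA
    subset_union_left subset_union_left).2 ⟨h1, h2⟩
  exact hind.mono_left hBAA hB hC (hind.symmetry _ _ _ hC hB hBAA h3)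
    (by rw [union_assoc]; exact subset_union_right)

theorem image_iff (hind : IsIndependenceRelation L κ ind) (σ : M ≃[L] M)
    (hA : #A < κ) (hB : #B < κ) (hC : #C < κ) :
    ind (σ '' A) (σ '' B) (σ '' C) ↔ ind A B C := by
  refine ⟨fun h => ?_, hind.invariance σ A B C hA hB hC⟩
  have := hind.invariance σ.symm _ _ _ (small_image hA σ) (small_image hB σ) (small_image hC σ) h
  simpa [image_image] using this

end IsIndependenceRelation

/-! ### The foundation rank -/

section Rank

variable {L : FirstOrder.Language.{u, v}} {M : Type w} [L.Structure M] {κ : Cardinal.{w}}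
  {ind : Set M → Set M → Set M → Prop} {m n : ℕ}

theorem URank_lt_of_forkingExtension {q p : (Fin n → M) × Set M}
    (h : ForkingExtension L κ ind q p) (hp : URank L κ ind p.1 p.2 ≠ ⊤) :
    URank L κ ind q.1 q.2 < URank L κ ind p.1 p.2 := by
  have hacc : Acc (ForkingExtension L κ ind) (p.1, p.2) := by
    by_contra hc
    exact hp (dif_neg hc)
  have hacc' : Acc (ForkingExtension L κ ind) (q.1, q.2) := hacc.inv h
  rw [URank, URank, dif_pos hacc, dif_pos hacc']
  exact WithTop.coe_lt_coe.2 (hacc.rank_lt_of_rel h)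

theorem URank_le_of_forall_forkingExtension {a : Fin n → M} {B : Set M} {o : WithTop Ordinal.{w}}
    (h : ∀ q, ForkingExtension L κ ind q (a, B) → URank L κ ind q.1 q.2 < o) :
    URank L κ ind a B ≤ o := by
  induction o using WithTop.recTopCoe with
  | top => exact le_top
  | coe o =>
    have hq : ∀ q, ForkingExtension L κ ind q (a, B) →
        ∃ hacc : Acc (ForkingExtension L κ ind) q, hacc.rank < o := fun q hq => by
      have := h q hq
      rw [URank] at this
      split_ifs at this with hacc
      · exact ⟨hacc, WithTop.coe_lt_coe.1 this⟩
      · exact absurd this not_top_lt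
    have hacc : Acc (ForkingExtension L κ ind) (a, B) := ⟨_, fun q hqp => (hq q hqp).1⟩
    rw [URank, dif_pos hacc, WithTop.coe_le_coe, hacc.rank_eq]
    refine Ordinal.iSup_le fun q => Order.succ_le_of_lt ?_
    exact (hq q.1 q.2).2

theorem ForkingExtension.image (hM : IsMonster L M κ) (hind : IsIndependenceRelation L κ ind)
    (σ : M ≃[L] M) {q p : (Fin n → M) × Set M} (hp : #p.2 < κ)
    (h : ForkingExtension L κ ind q p) :
    ForkingExtension L κ ind (σ ∘ q.1, σ '' q.2) (σ ∘ p.1, σ '' p.2) := by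
  obtain ⟨h1, h2, h3, h4⟩ := h
  refine ⟨image_mono h1, small_image h2 σ, ?_, ?_⟩
  · obtain ⟨τ, hτ, hτq⟩ := hM.exists_automorphism (hM.small_union hp (hM.small_range p.1)) h3
    have := sameType_of_automorphism ((σ.comp τ).comp σ.symm) (B := σ '' p.2)
      (by rintro _ ⟨b, hb, rfl⟩; simp [hτ b hb]) (σ ∘ p.1)
    convert this using 1
    ext i
    simp [← hτq]
  · change ¬ ind (range (σ ∘ q.1)) (σ '' p.2) (σ '' q.2)
    rw [range_comp, hind.image_iff σ (hM.small_range _) hp h2]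
    exact h4

theorem URank_image_le (hM : IsMonster L M κ) (hind : IsIndependenceRelation L κ ind)
    (σ : M ≃[L] M) (a : Fin n → M) {B : Set M} (hB : #B < κ) :
    URank L κ ind (σ ∘ a) (σ '' B) ≤ URank L κ ind a B := by
  induction hr : URank L κ ind a B using WellFoundedLT.induction generalizing a B with
  | ind r ih =>
    subst hr
    by_cases htop : URank L κ ind a B = ⊤
    · rw [htop]; exact le_top
    refine URank_le_of_forall_forkingExtension fun q hq => ?_
    have hq' := ForkingExtension.image hM hind σ.symm (small_image hB σ) hq
    have h1 : ForkingExtension L κ ind (σ.symm ∘ q.1, σ.symm '' q.2) (a, B) := by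
      convert hq' using 1
      ext : 1
      · ext i; simp
      · simp [image_image]
    have h2 := URank_lt_of_forkingExtension h1 htop
    refine lt_of_le_of_lt ?_ h2
    convert ih _ h2 (σ.symm ∘ q.1) h1.2.1 rfl using 1
    congr 1
    · ext i; simp
    · simp [image_image]

theorem URank_image (hM : IsMonster L M κ) (hind : IsIndependenceRelation L κ ind)
    (σ : M ≃[L] M) (a : Fin n → M) {B : Set M} (hB : #B < κ) :
    URank L κ ind (σ ∘ a) (σ '' B) = URank L κ ind a B := by
  refine (URank_image_le hM hind σ a hB).antisymm ?_
  convert URank_image_le hM hind σ.symm (σ ∘ a) (small_image hB σ) using 2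
  · ext i; simp
  · simp [image_image]

theorem URank_lt_of_not_ind {a : Fin n → M} {B C : Set M} (hC : #C < κ) (hBC : B ⊆ C)
    (h : ¬ ind (range a) B C) (htop : URank L κ ind a B ≠ ⊤) :
    URank L κ ind a C < URank L κ ind a B :=
  URank_lt_of_forkingExtension (q := (a, C)) (p := (a, B)) ⟨hBC, hC, fun _ => Iff.rfl, h⟩ htop

/-- To bound `U(a/B)` it suffices to consider forking extensions realized by `a` itself, since all
others are conjugate to such ones over `B`. -/
theorem URank_le_of_forall (hM : IsMonster L M κ) (hind : IsIndependenceRelation L κ ind)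
    {a : Fin n → M} {B : Set M} (hB : #B < κ) {o : WithTop Ordinal.{w}}
    (h : ∀ C, B ⊆ C → #C < κ → ¬ ind (range a) B C → URank L κ ind a C < o) :
    URank L κ ind a B ≤ o := by
  refine URank_le_of_forall_forkingExtension ?_
  rintro ⟨a', C⟩ ⟨h1, h2, h3, h4⟩
  obtain ⟨σ, hσ, rfl⟩ := hM.exists_automorphism (hM.small_union hB (hM.small_range a)) h3
  dsimp only at h1 h2 h4 ⊢
  have hC : σ '' (σ.symm '' C) = C := by simp [image_image]
  have hs : #(σ.symm '' C : Set M) < κ := small_image h2 _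
  rw [← hC, URank_image hM hind σ a hs]
  rw [range_comp, ← hC, ← image_eq_self_of_fixes hσ,
    hind.image_iff σ (hM.small_range a) hB hs] at h4
  refine h _ (fun b hb => ⟨b, h1 hb, ?_⟩) hs h4
  nth_rewrite 1 [← hσ b hb]
  simp

theorem URank_mono_base (hM : IsMonster L M κ) (hind : IsIndependenceRelation L κ ind)
    (a : Fin n → M) {B C : Set M} (hC : #C < κ) (hBC : B ⊆ C) :
    URank L κ ind a C ≤ URank L κ ind a B := by
  by_cases htop : URank L κ ind a B = ⊤
  · rw [htop]; exact le_top
  have hB := small_subset hC hBC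
  refine URank_le_of_forall hM hind hC fun D hCD hD h => ?_
  refine URank_lt_of_not_ind hD (hBC.trans hCD) (fun hi => h ?_) htop
  exact ((hind.transitivity _ B C D (hM.small_range a) hB hC hD hBC hCD).1 hi).2

theorem URank_mono_range (hM : IsMonster L M κ) (hind : IsIndependenceRelation L κ ind)
    {a : Fin n → M} {b : Fin m → M} (hab : range a ⊆ range b) {B : Set M} (hB : #B < κ) :
    URank L κ ind a B ≤ URank L κ ind b B := by
  induction hr : URank L κ ind b B using WellFoundedLT.induction generalizing B with
  | ind r ih =>
    subst hr
    by_cases htop : URank L κ ind b B = ⊤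
    · rw [htop]; exact le_top
    refine URank_le_of_forall hM hind hB fun C hBC hC h => ?_
    have h1 := URank_lt_of_not_ind (L := L) (a := b) hC hBC
      (fun hi => h (hind.mono_left (hM.small_range b) hB hC hi hab)) htop
    exact (ih _ h1 hC rfl).trans_lt h1

/-- Independent extensions preserve the rank. -/
theorem URank_le_of_ind (hM : IsMonster L M κ) (hind : IsIndependenceRelation L κ ind)
    {a : Fin n → M} {B C : Set M} (hC : #C < κ) (hBC : B ⊆ C) (h : ind (range a) B C) :
    URank L κ ind a B ≤ URank L κ ind a C := by
  induction hr : URank L κ ind a C using WellFoundedLT.induction generalizing B C with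
  | ind r ih =>
    subst hr
    by_cases htop : URank L κ ind a C = ⊤
    · rw [htop]; exact le_top
    have hB := small_subset hC hBC
    have ha := hM.small_range a
    have hBa := hM.small_union hB ha
    refine URank_le_of_forall hM hind hB fun D hBD hD hf => ?_
    -- replace `D` by a conjugate over `B ∪ range a` which is independent from `C`
    obtain ⟨σ, hσ, hi⟩ := hind.exists_automorphism_left hM hD hBa hC
    have hσa : σ ∘ a = a := funext fun i => hσ _ (Or.inr ⟨i, rfl⟩)
    have hσB : σ '' B = B := image_eq_self_of_fixes fun b hb => hσ b (Or.inl hb)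
    have hBD' : B ⊆ σ '' D := by
      rw [← hσB]; exact image_mono hBD
    have hD' : #(σ '' D : Set M) < κ := small_image hD σ
    have hf' : ¬ ind (range a) B (σ '' D) := by
      rw [← hind.image_iff σ ha hB hD, ← range_comp, hσa, hσB] at hf
      exact hf
    rw [← URank_image hM hind σ a hD, hσa]
    have hDC := hM.small_union hD' hC
    -- together with its conjugate `σ '' D`, `a` is independent from `C` over `B`, hence also over
    -- `σ '' D` alone
    have hiC : ind (range a) (σ '' D) (σ '' D ∪ C) := by
      have h1 := hind.union_left hM ha hD' hB hC h hi
      have haD := hM.small_union ha hD'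
      have h2 := hind.union_base_right hM hC hB haD (hind.symmetry _ _ _ haD hB hC h1)
      have h3 := ((hind.transitivity C B (σ '' D) (B ∪ (range a ∪ σ '' D)) hC hB hD'
        (hM.small_union hB haD) hBD' (by
          rw [← union_assoc]; exact subset_union_right)).1 h2).2
      refine hind.union_base_right hM ha hD' hC (hind.symmetry _ _ _ hC hD' ha ?_)
      refine hind.mono_right hC hD' (hM.small_union hB haD) h3 fun x hx => Or.inr (Or.inl hx)
    have hnot : ¬ ind (range a) C (σ '' D ∪ C) := fun hc => hf' <|
      hind.mono_right ha hB hDC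
        ((hind.transitivity _ B C _ ha hB hC hDC hBC subset_union_right).2 ⟨h, hc⟩)
        subset_union_left
    have hlt := URank_lt_of_not_ind (L := L) hDC subset_union_right hnot htop
    exact (ih _ hlt hDC subset_union_left hiC rfl).trans_lt hlt

theorem URank_eq_of_ind (hM : IsMonster L M κ) (hind : IsIndependenceRelation L κ ind)
    {a : Fin n → M} {B C : Set M} (hC : #C < κ) (hBC : B ⊆ C) (h : ind (range a) B C) :
    URank L κ ind a B = URank L κ ind a C :=
  (URank_le_of_ind hM hind hC hBC h).antisymm (URank_mono_base hM hind a hC hBC)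

theorem URank_eq_zero_of_subset (hM : IsMonster L M κ) (hind : IsIndependenceRelation L κ ind)
    {a : Fin n → M} {B : Set M} (hB : #B < κ) (ha : range a ⊆ B) : URank L κ ind a B = 0 := by
  refine le_antisymm (URank_le_of_forall hM hind hB fun C _ hC h => ?_) bot_le
  exact (h (hind.base_left hM hB hC ha)).elim

end Rank

/-! ### Natural sums of ordinals -/

section NaturalSum

open Ordinal

/-- The Hessenberg natural sum of two ordinals, as the least function which is strictly increasing
in both arguments. -/
noncomputable def naturalSum (a b : Ordinal.{w}) : Ordinal.{w} :=
  max (⨆ x : Iio a, Order.succ (naturalSum x b)) (⨆ y : Iio b, Order.succ (naturalSum a y))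
termination_by (a, b)
decreasing_by
  · exact Prod.Lex.left _ _ x.2
  · exact Prod.Lex.right _ y.2

theorem naturalSum_lt_left {a a' : Ordinal.{w}} (b : Ordinal.{w}) (h : a' < a) :
    naturalSum a' b < naturalSum a b := by
  rw [naturalSum.eq_1 a b]
  exact (Order.lt_succ _).trans_le ((Ordinal.le_iSup
    (fun x : Iio a => Order.succ (naturalSum x b)) ⟨a', h⟩).trans (le_max_left _ _))

theorem naturalSum_lt_right (a : Ordinal.{w}) {b b' : Ordinal.{w}} (h : b' < b) :
    naturalSum a b' < naturalSum a b := by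
  rw [naturalSum.eq_1 a b]
  exact (Order.lt_succ _).trans_le ((Ordinal.le_iSup
    (fun y : Iio b => Order.succ (naturalSum a y)) ⟨b', h⟩).trans (le_max_right _ _))

theorem naturalSum_le {a b c : Ordinal.{w}} (h₁ : ∀ a' < a, naturalSum a' b < c)
    (h₂ : ∀ b' < b, naturalSum a b' < c) : naturalSum a b ≤ c := by
  rw [naturalSum.eq_1 a b]
  exact max_le (Ordinal.iSup_le fun x => Order.succ_le_of_lt (h₁ _ x.2))
    (Ordinal.iSup_le fun y => Order.succ_le_of_lt (h₂ _ y.2))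

theorem naturalSum_mono {a a' b b' : Ordinal.{w}} (ha : a' ≤ a) (hb : b' ≤ b) :
    naturalSum a' b' ≤ naturalSum a b :=
  ((strictMono_of_lt_left b').monotone ha).trans ((strictMono_of_lt_right a).monotone hb)
where
  strictMono_of_lt_left (b : Ordinal.{w}) : StrictMono fun x => naturalSum x b :=
    fun _ _ => naturalSum_lt_left b
  strictMono_of_lt_right (a : Ordinal.{w}) : StrictMono fun y => naturalSum a y :=
    fun _ _ => naturalSum_lt_right a

theorem naturalSum_lt_of_lt_of_le {a a' b b' : Ordinal.{w}} (ha : a' < a) (hb : b' ≤ b) :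
    naturalSum a' b' < naturalSum a b :=
  (naturalSum_lt_left b' ha).trans_le (naturalSum_mono le_rfl hb)

theorem naturalSum_lt_of_le_of_lt {a a' b b' : Ordinal.{w}} (ha : a' ≤ a) (hb : b' < b) :
    naturalSum a' b' < naturalSum a b :=
  (naturalSum_mono ha le_rfl).trans_lt (naturalSum_lt_right a hb)

/-- An ordinal below `θ * n + ε` with `ε < θ` is `θ * k + ξ` with `ξ < θ` and `(k, ξ)` below
`(n, ε)` lexicographically. -/
theorem exists_nat_mul_add_of_lt {θ ε o : Ordinal.{w}} {n : ℕ} (hε : ε < θ)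
    (ho : o < θ * n + ε) :
    ∃ (k : ℕ) (ξ : Ordinal.{w}), ξ < θ ∧ o = θ * k + ξ ∧ (k < n ∨ k = n ∧ ξ < ε) := by
  have hθ : θ ≠ 0 := (bot_le.trans_lt hε).ne'
  have hlt : o < θ * ((n + 1 : ℕ) : Ordinal.{w}) := by
    rw [Nat.cast_succ, mul_add_one]
    exact ho.trans (add_lt_add_right hε _)
  have hdiv : o / θ < ((n + 1 : ℕ) : Ordinal.{w}) := (lt_mul_iff_div_lt hθ).1 hlt
  obtain ⟨k, hk⟩ := lt_omega0.1 (hdiv.trans (natCast_lt_omega0 _))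
  have hdm := div_add_mod o θ
  rw [hk] at hdiv hdm
  refine ⟨k, o % θ, mod_lt _ hθ, hdm.symm, ?_⟩
  rcases (Nat.lt_succ_iff.1 (Nat.cast_lt.1 hdiv)).lt_or_eq with h | rfl
  · exact Or.inl h
  · refine Or.inr ⟨rfl, ?_⟩
    rw [← hdm] at ho
    exact lt_of_add_lt_add_left ho

theorem naturalSum_nat_mul_add_le {θ : Ordinal.{w}}
    (hθ : ∀ ε < θ, ∀ ξ < θ, naturalSum ε ξ < θ) (a b : Ordinal.{w}) (m n : ℕ) {ε ξ : Ordinal.{w}}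
    (hε : ε < θ) (hξ : ξ < θ) (ha : a = θ * m + ε) (hb : b = θ * n + ξ) :
    naturalSum a b ≤ θ * ((m + n : ℕ) : Ordinal.{w}) + naturalSum ε ξ := by
  have hlt : ∀ (k l : ℕ) (η ζ : Ordinal.{w}), η < θ → k < l →
      θ * (k : Ordinal.{w}) + η < θ * (l : Ordinal.{w}) + ζ := fun k l η ζ hη hkl =>
    calc θ * (k : Ordinal.{w}) + η < θ * (k : Ordinal.{w}) + θ := add_lt_add_right hη _
      _ = θ * ((k + 1 : ℕ) : Ordinal.{w}) := by rw [Nat.cast_succ, mul_add_one]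
      _ ≤ θ * (l : Ordinal.{w}) := by gcongr; exact hkl
      _ ≤ _ := le_self_add
  refine naturalSum_le (fun a' ha' => ?_) (fun b' hb' => ?_)
  · obtain ⟨k, η, hη, hk, h⟩ := exists_nat_mul_add_of_lt hε (ha ▸ ha')
    refine (naturalSum_nat_mul_add_le hθ a' b k n hη hξ hk hb).trans_lt ?_
    rcases h with h | ⟨rfl, h⟩
    · exact hlt _ _ _ _ (hθ _ hη _ hξ) (by omega)
    · exact add_lt_add_right (naturalSum_lt_left _ h) _
  · obtain ⟨k, η, hη, hk, h⟩ := exists_nat_mul_add_of_lt hξ (hb ▸ hb')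
    refine (naturalSum_nat_mul_add_le hθ a b' m k hε hη ha hk).trans_lt ?_
    rcases h with h | ⟨rfl, h⟩
    · exact hlt _ _ _ _ (hθ _ hε _ hη) (by omega)
    · exact add_lt_add_right (naturalSum_lt_right _ h) _
termination_by (a, b)
decreasing_by
  · exact Prod.Lex.left _ _ ha'
  · exact Prod.Lex.right _ hb'

theorem naturalSum_lt_mul {θ : Ordinal.{w}} (hθ : ∀ ε < θ, ∀ ξ < θ, naturalSum ε ξ < θ)
    {a b : Ordinal.{w}} {m n : ℕ} (ha : a < θ * ((m + 1 : ℕ) : Ordinal.{w}))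
    (hb : b < θ * ((n + 1 : ℕ) : Ordinal.{w})) :
    naturalSum a b < θ * ((m + n + 1 : ℕ) : Ordinal.{w}) := by
  have hθ0 : 0 < θ := by
    rcases eq_or_ne θ 0 with rfl | h
    · simp at ha
    · exact bot_lt_iff_ne_bot.2 h
  obtain ⟨k, ε, hε, rfl, hk⟩ := exists_nat_mul_add_of_lt (o := a) (n := m + 1) hθ0
    (by rwa [add_zero])
  obtain ⟨l, ξ, hξ, rfl, hl⟩ := exists_nat_mul_add_of_lt (o := b) (n := n + 1) hθ0
    (by rwa [add_zero])
  have hk' : k < m + 1 := hk.resolve_right fun h => not_lt_bot h.2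
  have hl' : l < n + 1 := hl.resolve_right fun h => not_lt_bot h.2
  calc _ ≤ _ := naturalSum_nat_mul_add_le hθ _ _ k l hε hξ rfl rfl
    _ < θ * ((k + l : ℕ) : Ordinal.{w}) + θ := add_lt_add_right (hθ _ hε _ hξ) _
    _ = θ * ((k + l + 1 : ℕ) : Ordinal.{w}) := by rw [Nat.cast_succ (k + l), mul_add_one]
    _ ≤ _ := by gcongr <;> omega

/-- Powers of `ω` are closed under natural sums. -/
theorem naturalSum_lt_omega0_opow (δ : Ordinal.{w}) :
    ∀ ε < ω ^ δ, ∀ ξ < ω ^ δ, naturalSum ε ξ < ω ^ δ := by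
  induction δ using Ordinal.limitRecOn with
  | zero =>
    intro ε hε ξ hξ
    rw [opow_zero, Order.lt_one_iff] at *
    subst hε hξ
    exact le_bot_iff.1 (naturalSum_le (fun _ h => (not_lt_bot h).elim)
      fun _ h => (not_lt_bot h).elim)
  | add_one δ ih =>
    intro ε hε ξ hξ
    obtain ⟨m, hm⟩ := lt_omega0_opow_succ.1 hε
    obtain ⟨n, hn⟩ := lt_omega0_opow_succ.1 hξ
    refine lt_omega0_opow_succ.2 ⟨m + n + 1, naturalSum_lt_mul ih (hm.trans_le ?_)
      (hn.trans_le ?_)⟩ <;> gcongr <;> omega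
  | limit δ hδ ih =>
    intro ε hε ξ hξ
    obtain ⟨γ, hγ, h1⟩ := (lt_opow_of_isSuccLimit omega0_ne_zero hδ).1 hε
    obtain ⟨γ', hγ', h2⟩ := (lt_opow_of_isSuccLimit omega0_ne_zero hδ).1 hξ
    have hmax := max_lt hγ hγ'
    have hpos := omega0_pos.{w}
    refine (ih _ hmax ε (h1.trans_le ?_) ξ (h2.trans_le ?_)).trans_le ?_
    · exact opow_le_opow_right hpos (le_max_left _ _)
    · exact opow_le_opow_right hpos (le_max_right _ _)
    · exact opow_le_opow_right hpos hmax.le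

end NaturalSum

/-! ### The Lascar inequalities -/

section Lascar

variable {L : FirstOrder.Language.{u, v}} {M : Type w} [L.Structure M] {κ : Cardinal.{w}}
  {ind : Set M → Set M → Set M → Prop} {l m n : ℕ}

/-- The upper Lascar inequality: `U(ab/B) ≤ U(a/Bb) ⊕ U(b/B)`. Any enumeration `c` of the elements
of `a` and `b` can serve as the tuple `ab`, since `U` depends only on the range of a tuple. -/
theorem URank_le_naturalSum (hM : IsMonster L M κ) (hind : IsIndependenceRelation L κ ind)
    {a : Fin l → M} {b : Fin m → M} {c : Fin n → M} (hc : range c = range b ∪ range a)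
    {B : Set M} (hB : #B < κ) {α β : Ordinal.{w}}
    (hα : URank L κ ind a (B ∪ range b) = α) (hβ : URank L κ ind b B = β) :
    URank L κ ind c B ≤ (naturalSum α β : Ordinal.{w}) := by
  induction hr : naturalSum α β using WellFoundedLT.induction generalizing α β B with
  | ind r ih =>
    subst hr
    refine URank_le_of_forall hM hind hB fun C hBC hC hf => ?_
    have hBb := hM.small_union hB (hM.small_range b)
    have hCb := hM.small_union hC (hM.small_range b)
    have hsub : B ∪ range b ⊆ C ∪ range b := union_subset_union_left _ hBC
    have ha' := URank_mono_base hM hind a hCb hsub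
    have hb' := URank_mono_base hM hind b hC hBC
    obtain ⟨α', hα'⟩ := WithTop.ne_top_iff_exists.1
      (ne_top_of_le_ne_top (hα ▸ WithTop.coe_ne_top) ha')
    obtain ⟨β', hβ'⟩ := WithTop.ne_top_iff_exists.1
      (ne_top_of_le_ne_top (hβ ▸ WithTop.coe_ne_top) hb')
    -- by left transitivity, `ab` forks with `C` only if `a` forks over `Bb` or `b` forks over `B`
    have hlt : naturalSum α' β' < naturalSum α β := by
      rw [← hα', hα, WithTop.coe_le_coe] at ha'
      rw [← hβ', hβ, WithTop.coe_le_coe] at hb'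
      by_cases hi : ind (range b) B C
      · have hj : ¬ ind (range a) (B ∪ range b) (C ∪ range b) := fun hj => hf <| by
          rw [hc]
          exact hind.union_left hM (hM.small_range b) (hM.small_range a) hB hC hi
            (hind.mono_right (hM.small_range a) hBb hCb hj subset_union_left)
        have := URank_lt_of_not_ind (L := L) hCb hsub hj (hα ▸ WithTop.coe_ne_top)
        rw [hα, ← hα', WithTop.coe_lt_coe] at this
        exact naturalSum_lt_of_lt_of_le this hb'
      · have := URank_lt_of_not_ind (L := L) hC hBC hi (hβ ▸ WithTop.coe_ne_top)
        rw [hβ, ← hβ', WithTop.coe_lt_coe] at this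
        exact naturalSum_lt_of_le_of_lt ha' this
    exact (ih _ hlt hC hα'.symm hβ'.symm rfl).trans_lt (WithTop.coe_lt_coe.2 hlt)

/-- The lower Lascar inequality: `U(a/Bb) + U(b/B) ≤ U(ab/B)`. -/
theorem add_le_URank (hM : IsMonster L M κ) (hind : IsIndependenceRelation L κ ind)
    {a : Fin l → M} {b : Fin m → M} {c : Fin n → M} (hc : range c = range b ∪ range a)
    {B : Set M} (hB : #B < κ) {α β : Ordinal.{w}}
    (hα : URank L κ ind a (B ∪ range b) = α) (hβ : URank L κ ind b B = β) :
    ((α + β : Ordinal.{w}) : WithTop Ordinal.{w}) ≤ URank L κ ind c B := by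
  induction β using WellFoundedLT.induction generalizing B with
  | ind β ih =>
    by_cases htop : URank L κ ind c B = ⊤
    · rw [htop]; exact le_top
    obtain ⟨γ, hγ⟩ := WithTop.ne_top_iff_exists.1 htop
    have hb := hM.small_range b
    have ha := hM.small_range a
    have hBb := hM.small_union hB hb
    have hαc : URank L κ ind a (B ∪ range b) ≤ URank L κ ind c B :=
      (URank_mono_range hM hind (by rw [hc]; exact subset_union_right) hBb).trans
        (URank_mono_base hM hind c hBb subset_union_left)
    rw [← hγ, WithTop.coe_le_coe]
    rw [hα, ← hγ, WithTop.coe_le_coe] at hαc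
    rcases eq_or_ne β 0 with rfl | hβ0
    · rwa [add_zero]
    refine (Ordinal.add_le_iff hβ0).2 fun β' hβ' => ?_
    obtain ⟨C, hBC, hC, hf, hle⟩ : ∃ C, B ⊆ C ∧ #C < κ ∧ ¬ ind (range b) B C ∧
        (β' : WithTop Ordinal.{w}) ≤ URank L κ ind b C := by
      by_contra! hcon
      have := URank_le_of_forall hM hind hB hcon
      rw [hβ, WithTop.coe_le_coe] at this
      exact this.not_gt hβ'
    -- replace `C` by a conjugate over `B ∪ range b` which is independent from `a`
    obtain ⟨σ, hσ, hi⟩ := hind.exists_automorphism_right hM ha hBb hC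
    have hσb : σ ∘ b = b := funext fun i => hσ _ (Or.inr ⟨i, rfl⟩)
    have hσB : σ '' B = B := image_eq_self_of_fixes fun b hb => hσ b (Or.inl hb)
    have hBC' : B ⊆ σ '' C := by
      rw [← hσB]; exact image_mono hBC
    have hC' : #(σ '' C : Set M) < κ := small_image hC σ
    have hf' : ¬ ind (range b) B (σ '' C) := by
      rw [← hind.image_iff σ hb hB hC, ← range_comp, hσb, hσB] at hf
      exact hf
    rw [← URank_image hM hind σ b hC, hσb] at hle
    have hCb := hM.small_union hC' hb
    have hα' : URank L κ ind a (σ '' C ∪ range b) = α := by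
      rw [← hα]
      refine (URank_eq_of_ind hM hind hCb (union_subset_union_left _ hBC') ?_).symm
      have h1 := hind.union_base_right hM ha hBb hC' hi
      refine hind.mono_right ha hBb (hM.small_union hBb hC') h1 ?_
      rintro x (hx | hx)
      · exact Or.inr hx
      · exact Or.inl (Or.inr hx)
    have hlt := URank_lt_of_not_ind (L := L) hC' hBC' hf' (hβ ▸ WithTop.coe_ne_top)
    obtain ⟨η, hη⟩ := WithTop.ne_top_iff_exists.1 hlt.ne_top
    rw [hβ, ← hη, WithTop.coe_lt_coe] at hlt
    rw [← hη, WithTop.coe_le_coe] at hle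
    have h2 := ih η hlt hC' hα' hη.symm
    have h3 : URank L κ ind c (σ '' C) < URank L κ ind c B := by
      refine URank_lt_of_not_ind hC' hBC' (fun hi => hf' ?_) htop
      exact hind.mono_left (hM.small_range c) hB hC' hi (by rw [hc]; exact subset_union_left)
    have h4 := h2.trans_lt h3
    rw [← hγ, WithTop.coe_lt_coe] at h4
    exact (add_le_add_right hle α).trans_lt h4

end Lascar

/-! ### The coarse rank -/

section CoarseRank

variable (L : FirstOrder.Language.{u, v}) {M : Type w} [L.Structure M]

/-- The rank of every finite tuple over a small set is smaller than some finite multiple of `θ`. -/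
def HasFiniteCoarseRank (κ : Cardinal.{w}) (ind : Set M → Set M → Set M → Prop)
    (θ : Ordinal.{w}) : Prop :=
  ∀ (n : ℕ) (a : Fin n → M) (B : Set M), #B < κ →
    ∃ k : ℕ, URank L κ ind a B < ((θ * ((k + 1 : ℕ) : Ordinal.{w}) : Ordinal.{w}) : WithTop _)

/-- The coefficient of `θ` in `U(a/B)`: the unique natural number `k` with
`θ * k ≤ U(a/B) < θ * (k + 1)`. It is the junk value `0` if there is no such `k`. -/
noncomputable def coarseRank (κ : Cardinal.{w}) (ind : Set M → Set M → Set M → Prop)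
    (θ : Ordinal.{w}) {n : ℕ} (a : Fin n → M) (B : Set M) : ℕ :=
  sInf {k : ℕ | URank L κ ind a B <
    ((θ * ((k + 1 : ℕ) : Ordinal.{w}) : Ordinal.{w}) : WithTop Ordinal.{w})}

variable {L} {κ : Cardinal.{w}} {ind : Set M → Set M → Set M → Prop} {θ : Ordinal.{w}}
  {l m n : ℕ}

/-- Since `ω ^ δ` is closed under natural sums, the upper Lascar inequality reduces finiteness of
the coarse rank of tuples to that of elements. -/
theorem hasFiniteCoarseRank (hM : IsMonster L M κ) (hind : IsIndependenceRelation L κ ind)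
    {δ : Ordinal.{w}} (hθ : θ = Ordinal.omega0 ^ δ)
    (hU : ∀ a : M, ∃ n : ℕ, URank L κ ind ![a] ∅ ≤
      ((θ * (n : Ordinal.{w}) : Ordinal.{w}) : WithTop Ordinal.{w})) :
    HasFiniteCoarseRank L κ ind θ := by
  have hpos : 0 < θ := hθ ▸ Ordinal.opow_pos _ Ordinal.omega0_pos
  intro n
  induction n with
  | zero =>
    intro a B hB
    refine ⟨0, ?_⟩
    rw [URank_eq_zero_of_subset hM hind hB (by simp [range_eq_empty])]
    exact WithTop.coe_lt_coe.2 (by simpa using hpos)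
  | succ n ih =>
    intro a B hB
    obtain ⟨k, hk⟩ := hU (a 0)
    have hk' : URank L κ ind ![a 0] B <
        ((θ * ((k + 1 : ℕ) : Ordinal.{w}) : Ordinal.{w}) : WithTop Ordinal.{w}) :=
      ((URank_mono_base hM hind _ hB (empty_subset B)).trans hk).trans_lt
        (WithTop.coe_lt_coe.2 (by rw [Nat.cast_succ, mul_add_one]; exact lt_add_of_pos_right _ hpos))
    obtain ⟨j, hj⟩ := ih (fun i => a i.succ) (B ∪ range ![a 0])
      (hM.small_union hB (hM.small_range _))
    obtain ⟨β, hβ⟩ := WithTop.ne_top_iff_exists.1 hk'.ne_top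
    obtain ⟨α, hα⟩ := WithTop.ne_top_iff_exists.1 hj.ne_top
    refine ⟨j + k, (URank_le_naturalSum hM hind ?_ hB hα.symm hβ.symm).trans_lt ?_⟩
    · ext x
      simp [Fin.exists_fin_succ, eq_comm]
    · rw [← hβ, WithTop.coe_lt_coe] at hk'
      rw [← hα, WithTop.coe_lt_coe] at hj
      exact WithTop.coe_lt_coe.2
        (naturalSum_lt_mul (hθ ▸ naturalSum_lt_omega0_opow δ) hj hk')

theorem URank_lt_mul_coarseRank_add_one (hfin : HasFiniteCoarseRank L κ ind θ) (a : Fin n → M)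
    {B : Set M} (hB : #B < κ) : URank L κ ind a B <
      ((θ * ((coarseRank L κ ind θ a B + 1 : ℕ) : Ordinal.{w}) : Ordinal.{w}) : WithTop _) :=
  Nat.sInf_mem (s := {k : ℕ | URank L κ ind a B <
    ((θ * ((k + 1 : ℕ) : Ordinal.{w}) : Ordinal.{w}) : WithTop Ordinal.{w})}) (hfin n a B hB)

theorem coarseRank_le {a : Fin n → M} {B : Set M} {k : ℕ} (h : URank L κ ind a B <
      ((θ * ((k + 1 : ℕ) : Ordinal.{w}) : Ordinal.{w}) : WithTop Ordinal.{w})) :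
    coarseRank L κ ind θ a B ≤ k :=
  Nat.sInf_le h

theorem mul_coarseRank_le (a : Fin n → M) (B : Set M) :
    ((θ * (coarseRank L κ ind θ a B : Ordinal.{w}) : Ordinal.{w}) : WithTop Ordinal.{w}) ≤
      URank L κ ind a B := by
  rcases h : coarseRank L κ ind θ a B with _ | k
  · rw [Nat.cast_zero, mul_zero]; exact bot_le
  · by_contra! hlt
    have := coarseRank_le hlt
    omega

theorem le_coarseRank (hfin : HasFiniteCoarseRank L κ ind θ) {a : Fin n → M} {B : Set M}
    (hB : #B < κ) {k : ℕ}
    (h : ((θ * (k : Ordinal.{w}) : Ordinal.{w}) : WithTop Ordinal.{w}) ≤ URank L κ ind a B) :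
    k ≤ coarseRank L κ ind θ a B := by
  have := WithTop.coe_lt_coe.1 (h.trans_lt (URank_lt_mul_coarseRank_add_one hfin a hB))
  have := Nat.cast_lt.1 (lt_of_mul_lt_mul_left' this)
  omega

theorem coarseRank_mono_base (hM : IsMonster L M κ) (hind : IsIndependenceRelation L κ ind)
    (hfin : HasFiniteCoarseRank L κ ind θ) (a : Fin n → M) {B C : Set M} (hC : #C < κ)
    (hBC : B ⊆ C) : coarseRank L κ ind θ a C ≤ coarseRank L κ ind θ a B :=
  coarseRank_le ((URank_mono_base hM hind a hC hBC).trans_lt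
    (URank_lt_mul_coarseRank_add_one hfin a (small_subset hC hBC)))

theorem coarseRank_eq_zero_of_subset (hM : IsMonster L M κ) (hind : IsIndependenceRelation L κ ind)
    (hθ : 0 < θ) {a : Fin n → M} {B : Set M} (hB : #B < κ) (ha : range a ⊆ B) :
    coarseRank L κ ind θ a B = 0 := by
  refine Nat.le_zero.1 (coarseRank_le ?_)
  rw [URank_eq_zero_of_subset hM hind hB ha]
  exact WithTop.coe_lt_coe.2 (by simpa using hθ)

/-- The two Lascar inequalities agree up to `o(θ)`, which makes the coarse rank additive. -/
theorem coarseRank_add (hM : IsMonster L M κ) (hind : IsIndependenceRelation L κ ind)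
    (hnat : ∀ ε < θ, ∀ ξ < θ, naturalSum ε ξ < θ)
    (hfin : HasFiniteCoarseRank L κ ind θ) {a : Fin l → M} {b : Fin m → M} {c : Fin n → M}
    (hc : range c = range b ∪ range a) {B : Set M} (hB : #B < κ) :
    coarseRank L κ ind θ c B =
      coarseRank L κ ind θ a (B ∪ range b) + coarseRank L κ ind θ b B := by
  have h1 := URank_lt_mul_coarseRank_add_one hfin a (hM.small_union hB (hM.small_range b))
  have h2 := URank_lt_mul_coarseRank_add_one hfin b hB
  have h3 := mul_coarseRank_le (L := L) (κ := κ) (ind := ind) (θ := θ) a (B ∪ range b)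
  have h4 := mul_coarseRank_le (L := L) (κ := κ) (ind := ind) (θ := θ) b B
  obtain ⟨α, hα⟩ := WithTop.ne_top_iff_exists.1 h1.ne_top
  obtain ⟨β, hβ⟩ := WithTop.ne_top_iff_exists.1 h2.ne_top
  rw [← hα, WithTop.coe_lt_coe] at h1
  rw [← hβ, WithTop.coe_lt_coe] at h2
  rw [← hα, WithTop.coe_le_coe] at h3
  rw [← hβ, WithTop.coe_le_coe] at h4
  refine le_antisymm (coarseRank_le ?_) (le_coarseRank hfin hB ?_)
  · exact (URank_le_naturalSum hM hind hc hB hα.symm hβ.symm).trans_lt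
      (WithTop.coe_lt_coe.2 (naturalSum_lt_mul hnat h1 h2))
  · refine le_trans ?_ (add_le_URank hM hind hc hB hα.symm hβ.symm)
    rw [WithTop.coe_le_coe, Nat.cast_add, mul_add]
    exact add_le_add h3 h4

theorem tupleCoarsening_iff (hM : IsMonster L M κ) (hind : IsIndependenceRelation L κ ind)
    {δ : Ordinal.{w}} (hθ : θ = Ordinal.omega0 ^ δ) (hfin : HasFiniteCoarseRank L κ ind θ)
    (a : Fin n → M) {B C : Set M} (hB : #B < κ) (hC : #C < κ) :
    TupleCoarsening L κ ind θ a B C ↔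
      coarseRank L κ ind θ a B = coarseRank L κ ind θ a (B ∪ C) := by
  have hBC := hM.small_union hB hC
  have h1 := URank_lt_mul_coarseRank_add_one hfin a hB
  have h2 := URank_lt_mul_coarseRank_add_one hfin a hBC
  have hle := URank_mono_base hM hind a hBC subset_union_left
  have h3 := mul_coarseRank_le (L := L) (κ := κ) (ind := ind) (θ := θ) a (B ∪ C)
  obtain ⟨β, hβ⟩ := WithTop.ne_top_iff_exists.1 h1.ne_top
  obtain ⟨γ, hγ⟩ := WithTop.ne_top_iff_exists.1 h2.ne_top
  have hadd := hθ ▸ Ordinal.isPrincipal_add_omega0_opow δ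
  constructor
  · rintro ⟨ε, hε, h⟩
    refine le_antisymm (coarseRank_le ?_) (coarseRank_mono_base hM hind hfin a hBC
      subset_union_left)
    rw [h, ← hγ, ← WithTop.coe_add, WithTop.coe_lt_coe]
    rw [← hγ, WithTop.coe_lt_coe] at h2
    have hpos : 0 < θ := bot_le.trans_lt hε
    obtain ⟨k, η, hη, rfl, hk⟩ := exists_nat_mul_add_of_lt (o := γ) hpos (by rwa [add_zero])
    have hk' := hk.resolve_right fun h => not_lt_bot h.2
    calc θ * (k : Ordinal.{w}) + η + ε = θ * (k : Ordinal.{w}) + (η + ε) := add_assoc _ _ _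
      _ < θ * (k : Ordinal.{w}) + θ := add_lt_add_right (hadd hη hε) _
      _ = θ * ((k + 1 : ℕ) : Ordinal.{w}) := by rw [Nat.cast_succ, mul_add_one]
      _ ≤ _ := by gcongr; omega
  · intro h
    rw [← hβ, h, WithTop.coe_lt_coe] at h1
    rw [← hβ, ← hγ, WithTop.coe_le_coe] at hle
    rw [← hγ, WithTop.coe_le_coe] at h3
    refine ⟨β - γ, ?_, ?_⟩
    · by_contra! hle'
      rw [Nat.cast_succ, mul_add_one] at h1
      refine h1.not_ge ?_
      rw [← Ordinal.add_sub_cancel_of_le hle]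
      exact add_le_add h3 hle'
    · rw [← hβ, ← hγ, ← WithTop.coe_add, Ordinal.add_sub_cancel_of_le hle]

end CoarseRank

/-! ### Finite local character -/

section LocalCharacter

variable {L : FirstOrder.Language.{u, v}} {M : Type w} [L.Structure M] {κ : Cardinal.{w}}
  {ind : Set M → Set M → Set M → Prop} {θ : Ordinal.{w}} {n : ℕ}

theorem exists_range_eq_of_finite {A : Set M} (hA : A.Finite) :
    ∃ (n : ℕ) (a : Fin n → M), range a = A := by
  obtain ⟨n, f, hf⟩ := hA.fin_embedding
  exact ⟨n, f, hf⟩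

theorem exists_range_eq_union {m : ℕ} (b : Fin m → M) (a : Fin n → M) :
    ∃ (l : ℕ) (c : Fin l → M), range c = range b ∪ range a :=
  exists_range_eq_of_finite ((finite_range b).union (finite_range a))

theorem IsSuperior.exists_finite_base (hsup : IsSuperior κ ind) {A B : Set M} (hA : A.Finite)
    (hB : #B < κ) : ∃ B₀ ⊆ B, B₀.Finite ∧ ind A B₀ B := by
  -- the infimum is attained, as its value would otherwise be `sInf ∅ = 0`
  have hne : {μ : Cardinal.{w} | μ.IsRegular ∧ ∀ (n : ℕ) (a : Fin n → M) (B : Set M), #B < κ →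
      ∃ B₀ ⊆ B, #B₀ < μ ∧ ind (range a) B₀ B}.Nonempty := by
    by_contra hempty
    rw [not_nonempty_iff_eq_empty] at hempty
    have h : kappaZero κ ind = 0 := by rw [kappaZero, hempty, Cardinal.sInf_empty]
    exact aleph0_ne_zero (hsup.symm.trans h)
  have h := (csInf_mem hne).2
  obtain ⟨n, a, rfl⟩ := exists_range_eq_of_finite hA
  obtain ⟨B₀, h1, h2, h3⟩ := h n a B hB
  refine ⟨B₀, h1, lt_aleph0_iff_set_finite.1 (h2.trans_eq hsup), h3⟩

theorem isSuperior_of_exists_finite_base (h : ∀ (n : ℕ) (a : Fin n → M) (B : Set M), #B < κ →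
    ∃ B₀ ⊆ B, B₀.Finite ∧ ind (range a) B₀ B) : IsSuperior κ ind := by
  have hmem : ℵ₀ ∈ {μ : Cardinal.{w} | μ.IsRegular ∧ ∀ (n : ℕ) (a : Fin n → M) (B : Set M),
      #B < κ → ∃ B₀ ⊆ B, #B₀ < μ ∧ ind (range a) B₀ B} := by
    refine ⟨isRegular_aleph0, fun n a B hB => ?_⟩
    obtain ⟨B₀, h1, h2, h3⟩ := h n a B hB
    exact ⟨B₀, h1, lt_aleph0_iff_set_finite.2 h2, h3⟩
  exact le_antisymm (csInf_le' hmem) (le_csInf ⟨_, hmem⟩ fun μ hμ => hμ.1.aleph0_le)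

/-- The union of finite bases for all finite subsets of `A` is a base for `A`, by finite
character. -/
theorem IsSuperior.exists_small_base
    (hind : IsIndependenceRelation L κ ind) (hsup : IsSuperior κ ind) {A C : Set M}
    (hA : #A < κ) (hC : #C < κ) :
    ∃ C₀ ⊆ C, #C₀ < ℵ₀ + Order.succ #A ∧ ind A C₀ C := by
  choose f hf hfin hi using fun s : Finset A =>
    hsup.exists_finite_base (A := (↑) '' (s : Set A)) (s.finite_toSet.image _) hC
  have hsub : ⋃ s, f s ⊆ C := iUnion_subset hf
  refine ⟨⋃ s, f s, hsub, ?_, ?_⟩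
  · rcases finite_or_infinite A with hfA | hinf
    · exact (lt_aleph0_iff_set_finite.2 (finite_iUnion hfin)).trans_le le_self_add
    · refine lt_of_le_of_lt ?_ ((Order.lt_succ #A).trans_le (self_le_add_left _ _))
      refine (mk_iUnion_le f).trans ?_
      rw [mk_finset_of_infinite]
      refine (mul_le_mul_right (ciSup_le' fun s =>
        (lt_aleph0_iff_set_finite.2 (hfin s)).le) _).trans ?_
      rw [mul_aleph0_eq (aleph0_le_mk A)]
  · refine (hind.finite_character _ _ _ hA (small_subset hC hsub) hC).2 fun A₀ hA₀ hA₀fin => ?_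
    obtain ⟨s, rfl⟩ : ∃ s : Finset A, (↑) '' (s : Set A) = A₀ := by
      have hpre : ((↑) ⁻¹' A₀ : Set A).Finite := hA₀fin.preimage Subtype.val_injective.injOn
      refine ⟨hpre.toFinset, ?_⟩
      rw [Set.Finite.coe_toFinset, Subtype.image_preimage_coe, inter_eq_right.2 hA₀]
    exact ((hind.transitivity _ (f s) (⋃ s, f s) C (small_subset hA hA₀)
      (small_subset hC (hf s)) (small_subset hC hsub) hC (subset_iUnion f s) hsub).1 (hi s)).2

/-- The coarse rank of a tuple over `B ∪ C` is attained over `B` and finitely many elements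
of `C`. -/
theorem exists_coarseRank_eq (hM : IsMonster L M κ) (hind : IsIndependenceRelation L κ ind)
    (hsup : IsSuperior κ ind) (a : Fin n → M) {B C : Set M} (hB : #B < κ) (hC : #C < κ) :
    ∃ (m : ℕ) (c : Fin m → M), range c ⊆ C ∧
      coarseRank L κ ind θ a (B ∪ range c) = coarseRank L κ ind θ a (B ∪ C) := by
  have hBC := hM.small_union hB hC
  obtain ⟨D, hD, hDfin, hi⟩ := hsup.exists_finite_base (finite_range a) hBC
  obtain ⟨m, c, hc⟩ := exists_range_eq_of_finite (hDfin.inter_of_left C)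
  have hcC : range c ⊆ C := by rw [hc]; exact inter_subset_right
  have hsub : B ∪ range c ⊆ B ∪ C := union_subset_union_right _ hcC
  have hD' : D ⊆ B ∪ range c := by
    rw [hc]
    exact fun x hx => (hD hx).imp_right fun h => ⟨hx, h⟩
  refine ⟨m, c, hcC, ?_⟩
  rw [coarseRank, coarseRank, URank_eq_of_ind hM hind hBC hsub]
  exact ((hind.transitivity _ D _ _ (hM.small_range a) (hM.small_finite hDfin)
    (small_subset hBC hsub) hBC hD' hsub).1 hi).2

end LocalCharacter

/-! ### The coarsening -/

section Coarsening

variable {L : FirstOrder.Language.{u, v}} {M : Type w} [L.Structure M] {κ : Cardinal.{w}}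
  {ind : Set M → Set M → Set M → Prop} {δ θ : Ordinal.{w}} {n : ℕ} {A B C : Set M}

theorem coarsening_iff (hM : IsMonster L M κ) (hind : IsIndependenceRelation L κ ind)
    (hθ : θ = Ordinal.omega0 ^ δ) (hfin : HasFiniteCoarseRank L κ ind θ)
    (hB : #B < κ) (hC : #C < κ) :
    Coarsening L κ ind θ A B C ↔ ∀ (n : ℕ) (a : Fin n → M), range a ⊆ A →
      coarseRank L κ ind θ a B = coarseRank L κ ind θ a (B ∪ C) := by
  exact forall₃_congr fun n a _ => tupleCoarsening_iff hM hind hθ hfin a hB hC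

/-- If the coarse rank of `a` does not drop from `B` to `B ∪ C`, then neither does that of a tuple `b`
from the range of `a`: by additivity, `k(a/B) = k(a/Bb) + k(b/B)` and no summand can increase. -/
theorem coarsening_range_iff (hM : IsMonster L M κ) (hind : IsIndependenceRelation L κ ind)
    (hθ : θ = Ordinal.omega0 ^ δ) (hfin : HasFiniteCoarseRank L κ ind θ) (a : Fin n → M)
    (hB : #B < κ) (hC : #C < κ) :
    Coarsening L κ ind θ (range a) B C ↔ TupleCoarsening L κ ind θ a B C := by
  refine ⟨fun h => h n a subset_rfl, fun h => ?_⟩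
  have hnat := hθ ▸ naturalSum_lt_omega0_opow δ
  rw [tupleCoarsening_iff hM hind hθ hfin a hB hC] at h
  refine (coarsening_iff hM hind hθ hfin hB hC).2 fun m b hb => ?_
  have hBC := hM.small_union hB hC
  have hc : range a = range b ∪ range a := (union_eq_right.2 hb).symm
  have h1 := coarseRank_add hM hind hnat hfin hc hB
  have h2 := coarseRank_add hM hind hnat hfin hc hBC
  have h3 := coarseRank_mono_base hM hind hfin b hBC subset_union_left
  have h4 := coarseRank_mono_base hM hind hfin a (hM.small_union hBC (hM.small_range b))
    (union_subset_union_left (range b) (subset_union_left (s := B) (t := C)))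
  omega

theorem coarsening_of_ind (hM : IsMonster L M κ) (hind : IsIndependenceRelation L κ ind)
    (hθ : θ = Ordinal.omega0 ^ δ) (hfin : HasFiniteCoarseRank L κ ind θ)
    (hA : #A < κ) (hB : #B < κ) (hC : #C < κ) (h : ind A B C) :
    Coarsening L κ ind θ A B C := by
  refine (coarsening_iff hM hind hθ hfin hB hC).2 fun n a ha => ?_
  have h1 := hind.union_base_right hM (small_subset hA ha) hB hC
    (hind.mono_left hA hB hC h ha)
  rw [coarseRank, coarseRank, URank_eq_of_ind hM hind (hM.small_union hB hC) subset_union_left h1]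

/-- For finite tuples, coarse independence of `a` from `c` over `B` and of `c` from `a` over `B` both
mean that the coarse rank of `ac` over `B` is the sum of those of `a` and `c`. -/
theorem Coarsening.symm (hM : IsMonster L M κ) (hind : IsIndependenceRelation L κ ind)
    (hsup : IsSuperior κ ind) (hθ : θ = Ordinal.omega0 ^ δ)
    (hfin : HasFiniteCoarseRank L κ ind θ)
    (hA : #A < κ) (hB : #B < κ) (hC : #C < κ) (h : Coarsening L κ ind θ A B C) :
    Coarsening L κ ind θ C B A := by
  rw [coarsening_iff hM hind hθ hfin hB hC] at h
  refine (coarsening_iff hM hind hθ hfin hB hA).2 fun m c hc => ?_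
  obtain ⟨n, a, haA, ha⟩ := exists_coarseRank_eq (L := L) (θ := θ) hM hind hsup c hB hA
  obtain ⟨l, e, he⟩ := exists_range_eq_union a c
  have hnat := hθ ▸ naturalSum_lt_omega0_opow δ
  have h1 := coarseRank_add hM hind hnat hfin he hB
  have h2 := coarseRank_add hM hind hnat hfin (he.trans (union_comm _ _)) hB
  have h3 := coarseRank_mono_base hM hind hfin a (hM.small_union hB (hM.small_range c))
    subset_union_left
  have h4 := coarseRank_mono_base hM hind hfin a (hM.small_union hB hC)
    (union_subset_union_right B hc)
  have h5 := h n a haA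
  omega

/-- Adjoining elements of the base to a tuple does not change its coarse rank, by additivity. -/
theorem Coarsening.union_base (hM : IsMonster L M κ) (hind : IsIndependenceRelation L κ ind)
    (hθ : θ = Ordinal.omega0 ^ δ) (hfin : HasFiniteCoarseRank L κ ind θ)
    (hB : #B < κ) (hC : #C < κ) (h : Coarsening L κ ind θ A B C) :
    Coarsening L κ ind θ (A ∪ B) B C := by
  rw [coarsening_iff hM hind hθ hfin hB hC] at h ⊢
  intro n e he
  obtain ⟨l, a, ha⟩ := exists_range_eq_of_finite ((finite_range e).inter_of_left A)
  obtain ⟨m, b, hb⟩ := exists_range_eq_of_finite ((finite_range e).inter_of_left B)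
  have hbB : range b ⊆ B := by rw [hb]; exact inter_subset_right
  have hrange : range e = range b ∪ range a := by
    rw [ha, hb, ← inter_union_distrib_left, union_comm, inter_eq_left.2 he]
  have hnat := hθ ▸ naturalSum_lt_omega0_opow δ
  have hpos : 0 < θ := hθ ▸ Ordinal.opow_pos _ Ordinal.omega0_pos
  have key : ∀ D : Set M, #D < κ → B ⊆ D →
      coarseRank L κ ind θ e D = coarseRank L κ ind θ a D := fun D hD hBD => by
    rw [coarseRank_add hM hind hnat hfin hrange hD, union_eq_left.2 (hbB.trans hBD),
      coarseRank_eq_zero_of_subset hM hind hpos hD (hbB.trans hBD), add_zero]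
  rw [key B hB subset_rfl, key _ (hM.small_union hB hC) subset_union_left]
  exact h l a (by rw [ha]; exact inter_subset_right)

theorem Coarsening.image (hM : IsMonster L M κ) (hind : IsIndependenceRelation L κ ind)
    (σ : M ≃[L] M) (hB : #B < κ) (hC : #C < κ) (h : Coarsening L κ ind θ A B C) :
    Coarsening L κ ind θ (σ '' A) (σ '' B) (σ '' C) := by
  intro n a ha
  have ha' : a = σ ∘ (σ.symm ∘ a) := by ext i; simp
  have hsub : range (σ.symm ∘ a) ⊆ A := by
    rintro _ ⟨i, rfl⟩
    obtain ⟨x, hx, hxi⟩ := ha ⟨i, rfl⟩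
    simpa [← hxi] using hx
  obtain ⟨ε, hε, h⟩ := h n _ hsub
  refine ⟨ε, hε, ?_⟩
  rw [ha', ← image_union, URank_image hM hind σ _ hB,
    URank_image hM hind σ _ (hM.small_union hB hC), h]

theorem isIndependenceRelation_coarsening (hM : IsMonster L M κ)
    (hind : IsIndependenceRelation L κ ind) (hsup : IsSuperior κ ind)
    (hθ : θ = Ordinal.omega0 ^ δ) (hfin : HasFiniteCoarseRank L κ ind θ) :
    IsIndependenceRelation L κ (Coarsening L κ ind θ) where
  invariance σ A B C _ hB hC h := h.image hM hind σ hB hC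
  normality A B C _ hB hC h := h.union_base hM hind hθ hfin hC hB
  symmetry A B C hA hB hC h := h.symm hM hind hsup hθ hfin hA hB hC
  transitivity A B C D _ hB hC hD hBC hCD := by
    rw [coarsening_iff hM hind hθ hfin hB hD, coarsening_iff hM hind hθ hfin hB hC,
      coarsening_iff hM hind hθ hfin hC hD, union_eq_right.2 hBC, union_eq_right.2 hCD,
      union_eq_right.2 (hBC.trans hCD)]
    refine ⟨fun h => ⟨fun n a ha => ?_, fun n a ha => ?_⟩,
      fun h n a ha => (h.1 n a ha).trans (h.2 n a ha)⟩ <;>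
    · have h1 := h n a ha
      have h2 := coarseRank_mono_base hM hind hfin a hC hBC
      have h3 := coarseRank_mono_base hM hind hfin a hD hCD
      omega
  finite_character A B C _ _ _ :=
    ⟨fun h A₀ hA₀ _ n a ha => h n a (ha.trans hA₀),
      fun h n a ha => h (range a) ha (finite_range a) n a subset_rfl⟩
  extension A B C hA hB hC := by
    obtain ⟨f, hf, hi⟩ := hind.extension A B C hA hB hC
    exact ⟨f, hf, coarsening_of_ind hM hind hθ hfin (mk_range_le.trans_lt hA) hB hC hi⟩
  local_character := by
    refine ⟨ℵ₀, hM.aleph0_lt, fun A C hA hC => ?_⟩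
    obtain ⟨C₀, h1, h2, h3⟩ := hsup.exists_small_base hind hA hC
    exact ⟨C₀, h1, h2, coarsening_of_ind hM hind hθ hfin hA (small_subset hC h1) hC h3⟩

theorem isSuperior_coarsening (hM : IsMonster L M κ) (hind : IsIndependenceRelation L κ ind)
    (hsup : IsSuperior κ ind) (hθ : θ = Ordinal.omega0 ^ δ)
    (hfin : HasFiniteCoarseRank L κ ind θ) : IsSuperior κ (Coarsening L κ ind θ) := by
  refine isSuperior_of_exists_finite_base fun n a B hB => ?_
  obtain ⟨B₀, h1, h2, h3⟩ := hsup.exists_finite_base (finite_range a) hB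
  exact ⟨B₀, h1, h2,
    coarsening_of_ind hM hind hθ hfin (hM.small_range a) (hM.small_finite h2) hB h3⟩

end Coarsening

end IndepRel

theorem mainTheorem11 (L : FirstOrder.Language.{u, v}) (M : Type w) [L.Structure M]
    (κ : Cardinal.{w}) (hM : IndepRel.IsMonster L M κ)
    (ind : Set M → Set M → Set M → Prop)
    (hind : IndepRel.IsIndependenceRelation L κ ind)
    (hsup : IndepRel.IsSuperior κ ind)
    (δ θ : Ordinal.{w}) (hθ : θ = Ordinal.omega0 ^ δ)
    (hU : ∀ a : M, ∃ n : ℕ,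
      IndepRel.URank L κ ind ![a] ∅ ≤ ((θ * (n : Ordinal.{w}) : Ordinal.{w}) : WithTop Ordinal.{w})) :
    IndepRel.IsIndependenceRelation L κ (IndepRel.Coarsening L κ ind θ) ∧
    IndepRel.IsSuperior κ (IndepRel.Coarsening L κ ind θ) ∧
    (∀ A B C : Set M, #A < κ → #B < κ → #C < κ →
      ind A B C → IndepRel.Coarsening L κ ind θ A B C) ∧
    (∀ (n : ℕ) (a : Fin n → M) (B C : Set M), #B < κ → #C < κ →
      (IndepRel.Coarsening L κ ind θ (Set.range a) B C ↔
        IndepRel.TupleCoarsening L κ ind θ a B C)) := by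
  have hfin := IndepRel.hasFiniteCoarseRank hM hind hθ hU
  exact ⟨IndepRel.isIndependenceRelation_coarsening hM hind hsup hθ hfin,
    IndepRel.isSuperior_coarsening hM hind hsup hθ hfin,
    fun A B C => IndepRel.coarsening_of_ind hM hind hθ hfin,
    fun n a B C => IndepRel.coarsening_range_iff hM hind hθ hfin a⟩
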